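/- For $v\subseteq 1{:}m=\{1,\dots,m\}$ let $\partial^v g$ denote the mixed partial derivative of $g$ taken once with respect to each variable in $v$ (so $\partial^\emptyset g=g$, and $\partial_i\partial^v g=\partial^{v\cup\{i\}}g$ for $i\notin v$, irrespective of the order of differentiation), and let $u_v{:}1_{-v}$ be the point whose coordinates are $u_i$ for $i\in v$ and $1$ for $i\notin v$. The variation of $g:[0,1]^m\to\mathbb R$ in the sense of Hardy and Krause is $V_{HK}(g)=\sum_{\emptyset\ne v\subseteq 1:m}V_{IT}\bigl(g(\cdot_v{:}1_{-v})\bigr)$, where $V_{IT}$ is the Vitali variation, i.e. the supremum over all finite grids on $[0,1]^{|v|}$ of the sum over the cells of the absolute values of the $|v|$-fold differences; $g\in\mathrm{BVHK}$ means $V_{HK}(g)<\infty$. **Theorem.** Let $\tau=(\tau_1,\dots,\tau_d)$ map $[0,1]^m$ into a closed and bounded set $\mathcal X\subset\mathbb R^d$. Assume that every $\tau_j$ is continuous on $[0,1]$ in each variable separately, and that for every nonempty $v\subseteq 1{:}m$ the derivative $\partial^v\tau_j$ exists at all points $u\in(0,1]^m$ with $u_i<1$ for all $i\in v$. (Both hold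 in particular if all the derivatives $\partial^v\tau_j$ exist, one-sidedly at the boundary, everywhere on $[0,1]^m$.) Let $p_1,\dots,p_d\in[1,\infty]$ and assume that for all $j=1,\dots,d$ and all nonempty $v\subseteq 1{:}m$ the function $u_v\mapsto\partial^v\tau_j(u_v{:}1_{-v})$ belongs to $L^{p_j}([0,1]^{|v|})$. If $\sum_{j=1}^d 1/p_j\le 1$, then $f\circ\tau\in\mathrm{BVHK}$ for every $f\in C^m(\mathcal X)$, that is, for every $f$ that is $m$ times continuously differentiable on a neighbourhood of $\mathcal X$. -/

import Mathlib

open MeasureTheory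
open scoped ENNReal

/-- The alternating sum `∑_{w ⊆ ι} (-1)^|w| g(a_w : b_{-w})` of `g` over the vertices of the
box with corners `a` and `b`; for `a ≤ b` it is the `ι`-fold difference of `g` over the box. -/
def boxDiff {ι : Type*} [Fintype ι] [DecidableEq ι] (g : (ι → ℝ) → ℝ) (a b : ι → ℝ) : ℝ :=
  ∑ w : Finset ι, (-1 : ℝ) ^ w.card * g (fun i => if i ∈ w then a i else b i)

/-- The total variation in the sense of Vitali of `g` on the unit cube `[0,1]^ι`: the supremum,
over all grids given by finite partitions `0 = t i 0 ≤ t i 1 ≤ ⋯ ≤ t i (N i) = 1` of the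
coordinate axes, of the sum of the absolute differences of `g` over the cells of the grid. -/
noncomputable def vitaliVariation {ι : Type*} [Fintype ι] [DecidableEq ι]
    (g : (ι → ℝ) → ℝ) : ℝ≥0∞ :=
  ⨆ (N : ι → ℕ) (t : ι → ℕ → ℝ)
    (_ : ∀ i, Monotone (t i) ∧ t i 0 = 0 ∧ t i (N i) = 1),
    ∑ k ∈ Fintype.piFinset (fun i => Finset.range (N i)),
      ENNReal.ofReal |boxDiff g (fun i => t i (k i)) (fun i => t i (k i + 1))|

/-- The restriction of `g` to the face `u_{-v} = 1`: the map `x ↦ g(x_v : 1_{-v})`, as a function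
of the coordinates in `v` only. -/
def faceRestrict {m : ℕ} (v : Finset (Fin m)) (g : (Fin m → ℝ) → ℝ) : (v → ℝ) → ℝ :=
  fun x => g (fun i => if h : i ∈ v then x ⟨i, h⟩ else 1)

/-- The total variation of `g` on `[0,1]^m` in the sense of Hardy and Krause (anchored at `1`):
the sum over nonempty `v ⊆ 1:m` of the Vitali variations of `g` on the faces `u_{-v} = 1`. -/
noncomputable def hardyKrauseVariation {m : ℕ} (g : (Fin m → ℝ) → ℝ) : ℝ≥0∞ :=
  ∑ v : Finset (Fin m) with v.Nonempty, vitaliVariation (faceRestrict v g)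

/-- `g` has bounded variation on `[0,1]^m` in the sense of Hardy and Krause. -/
def IsBVHK {m : ℕ} (g : (Fin m → ℝ) → ℝ) : Prop :=
  hardyKrauseVariation g < ⊤

/-- `D v` is the mixed partial derivative `∂^v g`, once with respect to each variable in `v`,
for every `v ⊆ 1:m`, where `g` is a function on `[0,1]^m`.

The function `g` is continuous on `[0,1]` in each variable separately, `∂^∅ g = g`, and
`∂_i (∂^v g) = ∂^{v ∪ {i}} g` for `i ∉ v` at every point of `(0,1]^m` at which the variables in
`v ∪ {i}` are less than `1` (the other variables may be equal to `1`). Nothing is asked of the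
derivatives where some variable is `0` or where a variable of differentiation is `1`.
Ordinary (one-sided at the ends) existence of the derivatives on all of `[0,1]^m` implies this. -/
structure IsMixedPartials {m : ℕ} (g : (Fin m → ℝ) → ℝ)
    (D : Finset (Fin m) → (Fin m → ℝ) → ℝ) : Prop where
  continuousOn : ∀ u ∈ Set.Icc (0 : Fin m → ℝ) 1, ∀ i : Fin m,
    ContinuousOn (fun t : ℝ => g (Function.update u i t)) (Set.Icc 0 1)
  empty : ∀ u ∈ Set.Icc (0 : Fin m → ℝ) 1, D ∅ u = g u
  hasDerivAt : ∀ (v : Finset (Fin m)) (i : Fin m), i ∉ v →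
    ∀ u : Fin m → ℝ, (∀ k, u k ∈ Set.Ioc (0 : ℝ) 1) → (∀ k ∈ insert i v, u k < 1) →
      HasDerivAt (fun t : ℝ => D v (Function.update u i t)) (D (insert i v) u) (u i)

/-- `f` is of class `C^n` on the set `X`: it is `n` times continuously differentiable on a
neighbourhood of `X`. -/
def IsCnOn {d : ℕ} (n : ℕ) (X : Set (EuclideanSpace ℝ (Fin d)))
    (f : EuclideanSpace ℝ (Fin d) → ℝ) : Prop :=
  ∃ U : Set (EuclideanSpace ℝ (Fin d)), IsOpen U ∧ X ⊆ U ∧ ContDiffOn ℝ n f U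

/-! Everything is done on one fixed grid, with bounds independent of it. The sum over `v` of the
grid variations on the faces through the last node (the point 1) is a discrete Hardy–Krause norm,
`gridNorm`. It controls every slice of a function at a node (`gridNorm_slice_le`), hence is
submultiplicative up to a constant (`gridNorm_mul_le`).

Composition is then handled by induction on the set of directions, without Faà di Bruno. The
difference of `f ∘ τ` across a cell in direction `i` is `∫₀¹ ∑ⱼ Δτⱼ · (∂ⱼf)(σₓ) dx`, where `σₓ` runs
along the segment between the two slices of `τ`. The induction hypothesis bounds `∂ⱼf ∘ σₓ`, and the
norms of the `Δτⱼ` add up to at most that of `τⱼ`. Each direction costs one derivative of `f`, so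
`m` suffice (`exists_gridNorm_comp_le`).

It remains to bound the norm of each `τⱼ`. On a face, the fundamental theorem of calculus applied
one variable at a time bounds the grid variation by the integral of `|∂^v τⱼ|`
(`IsMixedPartials.exists_gridVar_le`), which is finite because `L^p ⊆ L^1` on the cube. -/

/-! ### Differences and Hardy–Krause norms on a grid -/

section Grid

variable {ι : Type*} [DecidableEq ι]

/-- The vertex of the `k`-th cell of the grid `t` on the face in the directions `v` through `u`,
lying at the lower end in the directions `w` and at the upper end in the others. -/
def gridVertex (t : ι → ℕ → ℝ) (v w : Finset ι) (k : ι → ℕ) (u : ι → ℝ) : ι → ℝ :=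
  fun i => if i ∈ v then (if i ∈ w then t i (k i) else t i (k i + 1)) else u i

/-- The `v`-fold difference of `F` over the `k`-th cell of the grid `t`, the other coordinates
being those of `u`. -/
def gridDiff (t : ι → ℕ → ℝ) (v : Finset ι) (k : ι → ℕ) (F : (ι → ℝ) → ℝ) (u : ι → ℝ) : ℝ :=
  ∑ w ∈ v.powerset, (-1 : ℝ) ^ w.card * F (gridVertex t v w k u)

/-- The difference of `F` in the direction `i` over the `n`-th cell of `t i`. -/
def axisDiff (t : ι → ℕ → ℝ) (i : ι) (n : ℕ) (F : (ι → ℝ) → ℝ) : (ι → ℝ) → ℝ :=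
  fun u => F (Function.update u i (t i (n + 1))) - F (Function.update u i (t i n))

theorem gridVertex_update_cell {t : ι → ℕ → ℝ} {v w : Finset ι} {i : ι} (hi : i ∉ v)
    (k : ι → ℕ) (n : ℕ) (u : ι → ℝ) :
    gridVertex t v w (Function.update k i n) u = gridVertex t v w k u := by
  ext j
  by_cases hj : j ∈ v
  · have : j ≠ i := fun h => hi (h ▸ hj)
    simp [gridVertex, hj, this]
  · simp [gridVertex, hj]

theorem gridVertex_update_base {t : ι → ℕ → ℝ} {v w : Finset ι} {i : ι} (hi : i ∉ v)
    (k : ι → ℕ) (u : ι → ℝ) (x : ℝ) :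
    gridVertex t v w k (Function.update u i x) = Function.update (gridVertex t v w k u) i x := by
  ext j
  by_cases hj : j = i
  · subst hj; simp [gridVertex, hi]
  · simp [gridVertex, hj]

theorem gridVertex_insert_upper {t : ι → ℕ → ℝ} {v w : Finset ι} {i : ι} (hi : i ∉ w)
    (k : ι → ℕ) (u : ι → ℝ) :
    gridVertex t (insert i v) w k u
      = Function.update (gridVertex t v w k u) i (t i (k i + 1)) := by
  ext j
  by_cases hj : j = i
  · subst hj; simp [gridVertex, hi]
  · simp [gridVertex, hj]

theorem gridVertex_insert_lower {t : ι → ℕ → ℝ} {v w : Finset ι} {i : ι}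
    (k : ι → ℕ) (u : ι → ℝ) :
    gridVertex t (insert i v) (insert i w) k u
      = Function.update (gridVertex t v w k u) i (t i (k i)) := by
  ext j
  by_cases hj : j = i
  · subst hj; simp [gridVertex]
  · simp [gridVertex, hj]

theorem gridDiff_insert {t : ι → ℕ → ℝ} {v : Finset ι} {i : ι} (hi : i ∉ v)
    (k : ι → ℕ) (F : (ι → ℝ) → ℝ) (u : ι → ℝ) :
    gridDiff t (insert i v) k F u = gridDiff t v k (axisDiff t i (k i) F) u := by
  unfold gridDiff
  rw [Finset.sum_powerset_insert hi, ← Finset.sum_add_distrib]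
  refine Finset.sum_congr rfl fun w hw => ?_
  have hiw : i ∉ w := fun h => hi (Finset.mem_powerset.1 hw h)
  rw [gridVertex_insert_upper hiw, gridVertex_insert_lower, Finset.card_insert_of_notMem hiw,
    axisDiff]
  ring

theorem gridDiff_update_cell {t : ι → ℕ → ℝ} {v : Finset ι} {i : ι} (hi : i ∉ v)
    (k : ι → ℕ) (n : ℕ) (F : (ι → ℝ) → ℝ) (u : ι → ℝ) :
    gridDiff t v (Function.update k i n) F u = gridDiff t v k F u := by
  simp only [gridDiff, gridVertex_update_cell hi]

theorem gridDiff_add (t : ι → ℕ → ℝ) (v : Finset ι) (k : ι → ℕ) (F G : (ι → ℝ) → ℝ)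
    (u : ι → ℝ) :
    gridDiff t v k (fun p => F p + G p) u = gridDiff t v k F u + gridDiff t v k G u := by
  simp only [gridDiff, mul_add, Finset.sum_add_distrib]

theorem gridDiff_const_mul (t : ι → ℕ → ℝ) (v : Finset ι) (k : ι → ℕ) (c : ℝ)
    (F : (ι → ℝ) → ℝ) (u : ι → ℝ) :
    gridDiff t v k (fun p => c * F p) u = c * gridDiff t v k F u := by
  simp only [gridDiff, Finset.mul_sum]
  exact Finset.sum_congr rfl fun w _ => by ring

variable [Fintype ι]

/-- The sum over the cells of the grid `t` in the directions `v` of the absolute `v`-fold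
differences of `F`, the other coordinates being those of `u`. -/
noncomputable def gridVar (t : ι → ℕ → ℝ) (N : ι → ℕ) (v : Finset ι) (F : (ι → ℝ) → ℝ)
    (u : ι → ℝ) : ℝ≥0∞ :=
  ∑ k ∈ Fintype.piFinset (fun i => if i ∈ v then Finset.range (N i) else {0}),
    ‖gridDiff t v k F u‖ₑ

/-- The sum of the grid variations of `F` over all sets of directions contained in `S`: a norm of
Hardy–Krause type, relative to one grid. -/
noncomputable def gridNorm (t : ι → ℕ → ℝ) (N : ι → ℕ) (S : Finset ι) (F : (ι → ℝ) → ℝ)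
    (u : ι → ℝ) : ℝ≥0∞ :=
  ∑ v ∈ S.powerset, gridVar t N v F u

variable {t : ι → ℕ → ℝ} {N : ι → ℕ} {v S : Finset ι}
  {F G : (ι → ℝ) → ℝ} {u : ι → ℝ}

/-- Cell indices are pinned to 0 outside `v`, so a cell in the directions `insert i v` is a pair: an
index `n` in direction `i` and a cell in the directions `v`. This makes induction on the directions
possible. -/
theorem gridVar_insert {i : ι} (hi : i ∉ v) (F : (ι → ℝ) → ℝ) (u : ι → ℝ) :
    gridVar t N (insert i v) F u
      = ∑ n ∈ Finset.range (N i), gridVar t N v (axisDiff t i n F) u := by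
  unfold gridVar
  rw [← Finset.sum_product']
  refine Finset.sum_nbij' (fun k => (k i, Function.update k i 0))
    (fun q => Function.update q.2 i q.1) ?_ ?_ ?_ ?_ ?_
  · intro k hk
    rw [Fintype.mem_piFinset] at hk
    rw [Finset.mem_product, Fintype.mem_piFinset]
    refine ⟨by simpa using hk i, fun j => ?_⟩
    by_cases hj : j = i
    · subst hj; simp [hi]
    · simpa [hj] using hk j
  · rintro ⟨n, k⟩ hk
    rw [Finset.mem_product, Fintype.mem_piFinset] at hk
    rw [Fintype.mem_piFinset]
    intro j
    by_cases hj : j = i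
    · subst hj; simpa using hk.1
    · simpa [hj] using hk.2 j
  · intro k _; simp
  · rintro ⟨n, k⟩ hk
    rw [Finset.mem_product, Fintype.mem_piFinset] at hk
    have := hk.2 i
    simp only [hi, if_false, Finset.mem_singleton] at this
    simp [← this]
  · intro k _
    rw [gridDiff_insert hi, gridDiff_update_cell hi]

theorem gridVar_empty (F : (ι → ℝ) → ℝ) (u : ι → ℝ) : gridVar t N ∅ F u = ‖F u‖ₑ := by
  simp [gridVar, gridDiff, show ∀ k, gridVertex t ∅ ∅ k u = u from fun k => by ext; simp [gridVertex]]

theorem gridVar_add_le (F G : (ι → ℝ) → ℝ) (u : ι → ℝ) :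
    gridVar t N v (fun p => F p + G p) u ≤ gridVar t N v F u + gridVar t N v G u := by
  unfold gridVar
  rw [← Finset.sum_add_distrib]
  refine Finset.sum_le_sum fun k _ => ?_
  rw [gridDiff_add]
  exact enorm_add_le _ _

theorem gridVar_const_mul (c : ℝ) (F : (ι → ℝ) → ℝ) (u : ι → ℝ) :
    gridVar t N v (fun p => c * F p) u = ‖c‖ₑ * gridVar t N v F u := by
  simp only [gridVar, gridDiff_const_mul, enorm_mul, Finset.mul_sum]

theorem gridVar_update_base {i : ι} (hi : i ∉ v) (F : (ι → ℝ) → ℝ) (u : ι → ℝ) (x : ℝ) :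
    gridVar t N v (fun p => F (Function.update p i x)) u
      = gridVar t N v F (Function.update u i x) := by
  simp only [gridVar, gridDiff, gridVertex_update_base hi]

theorem gridVar_congr {A : Set (ι → ℝ)} (hA : ∀ w k, gridVertex t v w k u ∈ A)
    (hFG : ∀ p ∈ A, F p = G p) : gridVar t N v F u = gridVar t N v G u := by
  unfold gridVar gridDiff
  refine Finset.sum_congr rfl fun k _ => ?_
  congr 1
  exact Finset.sum_congr rfl fun w _ => by rw [hFG _ (hA w k)]

theorem gridNorm_empty (F : (ι → ℝ) → ℝ) (u : ι → ℝ) : gridNorm t N ∅ F u = ‖F u‖ₑ := by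
  simp [gridNorm, gridVar_empty]

theorem gridNorm_insert {i : ι} (hi : i ∉ S) (F : (ι → ℝ) → ℝ) (u : ι → ℝ) :
    gridNorm t N (insert i S) F u
      = gridNorm t N S F u
        + ∑ n ∈ Finset.range (N i), gridNorm t N S (axisDiff t i n F) u := by
  unfold gridNorm
  rw [Finset.sum_powerset_insert hi]
  congr 1
  rw [Finset.sum_comm]
  refine Finset.sum_congr rfl fun v hv => gridVar_insert ?_ _ _
  exact fun h => hi (Finset.mem_powerset.1 hv h)

theorem gridNorm_add_le (F G : (ι → ℝ) → ℝ) (u : ι → ℝ) :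
    gridNorm t N S (fun p => F p + G p) u ≤ gridNorm t N S F u + gridNorm t N S G u := by
  unfold gridNorm
  rw [← Finset.sum_add_distrib]
  exact Finset.sum_le_sum fun v _ => gridVar_add_le _ _ _

theorem gridNorm_const_mul (c : ℝ) (F : (ι → ℝ) → ℝ) (u : ι → ℝ) :
    gridNorm t N S (fun p => c * F p) u = ‖c‖ₑ * gridNorm t N S F u := by
  simp only [gridNorm, gridVar_const_mul, Finset.mul_sum]

theorem gridNorm_update_base {i : ι} (hi : i ∉ S) (F : (ι → ℝ) → ℝ) (u : ι → ℝ) (x : ℝ) :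
    gridNorm t N S (fun p => F (Function.update p i x)) u
      = gridNorm t N S F (Function.update u i x) := by
  unfold gridNorm
  exact Finset.sum_congr rfl fun v hv =>
    gridVar_update_base (fun h => hi (Finset.mem_powerset.1 hv h)) _ _ _

theorem gridNorm_sum_le {κ : Type*} (s : Finset κ) (F : κ → (ι → ℝ) → ℝ) (u : ι → ℝ) :
    gridNorm t N S (fun p => ∑ j ∈ s, F j p) u ≤ ∑ j ∈ s, gridNorm t N S (F j) u := by
  classical
  induction s using Finset.induction_on with
  | empty => simpa using (gridNorm_const_mul (t := t) (N := N) (S := S) 0 (fun _ => 0) u).le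
  | insert j s hj ih =>
    simp only [Finset.sum_insert hj]
    exact (gridNorm_add_le _ _ _).trans (by gcongr)

/-- The value of a function at a node of the grid is controlled in norm by its value at the last
node and its differences. -/
theorem gridNorm_slice_le {i : ι} (hi : i ∉ S) (hu : t i (N i) = u i) {n : ℕ} (hn : n ≤ N i) :
    gridNorm t N S (fun p => F (Function.update p i (t i n))) u
      ≤ gridNorm t N (insert i S) F u := by
  rw [gridNorm_insert hi]
  -- Telescoping downwards from the last node, where the slice is `F` itself because `t i (N i) = u
  -- i`.
  suffices h : ∀ r, r ≤ N i → gridNorm t N S (fun p => F (Function.update p i (t i (N i - r)))) u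
      ≤ gridNorm t N S F u + ∑ n ∈ Finset.Ico (N i - r) (N i),
        gridNorm t N S (axisDiff t i n F) u by
    have := h (N i - n) (Nat.sub_le _ _)
    rw [Nat.sub_sub_self hn] at this
    refine this.trans ?_
    gcongr
    intro a ha
    simp only [Finset.mem_Ico] at ha
    simpa using ha.2
  intro r
  induction r with
  | zero =>
    intro _
    rw [Nat.sub_zero, gridNorm_update_base hi, hu, Function.update_eq_self]
    exact le_self_add
  | succ r ih =>
    intro hr
    have h1 := ih (by omega)
    set a := N i - (r + 1) with ha
    have h2 : N i - r = a + 1 := by omega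
    rw [h2] at h1
    rw [Finset.sum_eq_sum_Ico_succ_bot (by omega : a < N i)]
    have h3 : (fun p => F (Function.update p i (t i a)))
        = fun p => F (Function.update p i (t i (a + 1))) + (-1) * axisDiff t i a F p := by
      ext p; simp [axisDiff]
    rw [h3]
    refine (gridNorm_add_le _ _ _).trans ?_
    rw [gridNorm_const_mul]
    simp only [enorm_neg, enorm_one, one_mul]
    calc _ ≤ _ := add_le_add_left h1 _
      _ = _ := by ring

/-- Discrete Leibniz rule in each new direction. The factor 3 counts the undifferenced product and
the two Leibniz terms; in these, the undifferenced factor is a slice, controlled by the full norm.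
-/
theorem gridNorm_mul_le (hu : ∀ i ∈ S, t i (N i) = u i) (F G : (ι → ℝ) → ℝ) :
    gridNorm t N S (fun p => F p * G p) u
      ≤ 3 ^ S.card * (gridNorm t N S F u * gridNorm t N S G u) := by
  induction S using Finset.induction_on generalizing F G with
  | empty => simp [gridNorm_empty]
  | insert i S hi ih =>
    have hu' : ∀ j ∈ S, t j (N j) = u j := fun j hj => hu j (Finset.mem_insert_of_mem hj)
    have hui := hu i (Finset.mem_insert_self i S)
    have key : ∀ n ∈ Finset.range (N i), gridNorm t N S (axisDiff t i n fun p => F p * G p) u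
        ≤ 3 ^ S.card * (gridNorm t N S (axisDiff t i n F) u * gridNorm t N (insert i S) G u)
          + 3 ^ S.card * (gridNorm t N (insert i S) F u
            * gridNorm t N S (axisDiff t i n G) u) := by
      intro n hn
      have hn' : n < N i := Finset.mem_range.1 hn
      have h3 : (axisDiff t i n fun p => F p * G p)
          = fun p => axisDiff t i n F p * G (Function.update p i (t i (n + 1)))
            + F (Function.update p i (t i n)) * axisDiff t i n G p := by
        ext p; simp only [axisDiff]; ring
      rw [h3]
      refine (gridNorm_add_le _ _ _).trans (add_le_add ?_ ?_)
      · refine (ih hu' _ _).trans ?_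
        gcongr
        exact gridNorm_slice_le hi hui hn'
      · refine (ih hu' _ _).trans ?_
        gcongr
        exact gridNorm_slice_le hi hui hn'.le
    have hF : gridNorm t N S F u ≤ gridNorm t N (insert i S) F u := by
      rw [gridNorm_insert hi]; exact le_self_add
    have hG : gridNorm t N S G u ≤ gridNorm t N (insert i S) G u := by
      rw [gridNorm_insert hi]; exact le_self_add
    have hF' : ∑ n ∈ Finset.range (N i), gridNorm t N S (axisDiff t i n F) u
        ≤ gridNorm t N (insert i S) F u := by
      rw [gridNorm_insert hi]; exact le_add_self
    have hG' : ∑ n ∈ Finset.range (N i), gridNorm t N S (axisDiff t i n G) u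
        ≤ gridNorm t N (insert i S) G u := by
      rw [gridNorm_insert hi]; exact le_add_self
    rw [gridNorm_insert hi (fun p => F p * G p)]
    calc _ ≤ 3 ^ S.card * (gridNorm t N S F u * gridNorm t N S G u) + _ :=
          add_le_add (ih hu' F G) (Finset.sum_le_sum key)
      _ = 3 ^ S.card * (gridNorm t N S F u * gridNorm t N S G u)
          + (3 ^ S.card * ((∑ n ∈ Finset.range (N i), gridNorm t N S (axisDiff t i n F) u)
              * gridNorm t N (insert i S) G u)
            + 3 ^ S.card * (gridNorm t N (insert i S) F u
              * ∑ n ∈ Finset.range (N i), gridNorm t N S (axisDiff t i n G) u)) := by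
          rw [Finset.sum_add_distrib, Finset.sum_mul, Finset.mul_sum, Finset.mul_sum,
            Finset.mul_sum]
      _ ≤ 3 ^ S.card * (gridNorm t N (insert i S) F u * gridNorm t N (insert i S) G u)
          + (3 ^ S.card * (gridNorm t N (insert i S) F u * gridNorm t N (insert i S) G u)
            + 3 ^ S.card * (gridNorm t N (insert i S) F u * gridNorm t N (insert i S) G u)) := by
          gcongr
      _ = _ := by
          rw [Finset.card_insert_of_notMem hi, pow_succ]
          ring

/-! ### Bounds by integrals of derivatives -/

/-- If the right side is infinite there is nothing to prove; otherwise `f'`, which is measurable as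
it agrees with `deriv f`, is integrable and the fundamental theorem of calculus applies. -/
theorem enorm_sub_le_lintegral_of_hasDerivAt {f f' : ℝ → ℝ} {a b : ℝ} (hab : a ≤ b)
    (h : ∀ x ∈ Set.Icc a b, HasDerivAt f (f' x) x) :
    ‖f b - f a‖ₑ ≤ ∫⁻ x in Set.Ioc a b, ‖f' x‖ₑ := by
  by_cases hfin : ∫⁻ x in Set.Ioc a b, ‖f' x‖ₑ = ⊤
  · rw [hfin]; exact le_top
  have hmeas : AEStronglyMeasurable f' (volume.restrict (Set.Ioc a b)) := by
    refine (aestronglyMeasurable_deriv f _).congr ?_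
    filter_upwards [ae_restrict_mem measurableSet_Ioc] with x hx
    exact (h x (Set.Ioc_subset_Icc_self hx)).deriv
  have hint : IntervalIntegrable f' volume a b := by
    rw [intervalIntegrable_iff_integrableOn_Ioc_of_le hab]
    exact ⟨hmeas, lt_top_iff_ne_top.2 hfin⟩
  rw [← intervalIntegral.integral_eq_sub_of_hasDerivAt (by rwa [Set.uIcc_of_le hab]) hint,
    intervalIntegral.integral_of_le hab]
  exact enorm_integral_le_lintegral_enorm _

/-- Superadditivity of the lower integral needs no measurability, so none has to be checked for the
integrands below. -/
theorem sum_lintegral_le_lintegral_sum {α κ : Type*} [MeasurableSpace α] (μ : Measure α)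
    (s : Finset κ) (f : κ → α → ℝ≥0∞) :
    ∑ j ∈ s, ∫⁻ x, f j x ∂μ ≤ ∫⁻ x, ∑ j ∈ s, f j x ∂μ := by
  classical
  induction s using Finset.induction_on with
  | empty => simp
  | insert j s hj ih =>
    simp only [Finset.sum_insert hj]
    exact (add_le_add_right ih _).trans (le_lintegral_add _ _)

/-- Differentiation in the parameter commutes with `gridDiff`, a finite linear combination of point
values. -/
theorem gridVar_sub_le_lintegral {H H' : ℝ → (ι → ℝ) → ℝ} {a b : ℝ} (hab : a ≤ b)
    (h : ∀ w k, ∀ x ∈ Set.Icc a b,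
      HasDerivAt (fun y => H y (gridVertex t v w k u)) (H' x (gridVertex t v w k u)) x) :
    gridVar t N v (fun p => H b p - H a p) u
      ≤ ∫⁻ x in Set.Ioc a b, gridVar t N v (H' x) u := by
  unfold gridVar
  refine le_trans (Finset.sum_le_sum fun k _ => ?_) (sum_lintegral_le_lintegral_sum _ _ _)
  have h1 : gridDiff t v k (fun p => H b p - H a p) u
      = gridDiff t v k (H b) u - gridDiff t v k (H a) u := by
    simp only [gridDiff, mul_sub, Finset.sum_sub_distrib]
  rw [h1]
  refine enorm_sub_le_lintegral_of_hasDerivAt (f := fun y => gridDiff t v k (H y) u) hab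
    fun x hx => ?_
  exact HasDerivAt.fun_sum fun w _ => (h w k x hx).const_mul _

theorem gridNorm_sub_le_lintegral {H H' : ℝ → (ι → ℝ) → ℝ} {a b : ℝ} (hab : a ≤ b)
    (h : ∀ p, ∀ x ∈ Set.Icc a b, HasDerivAt (fun y => H y p) (H' x p) x) :
    gridNorm t N S (fun p => H b p - H a p) u
      ≤ ∫⁻ x in Set.Ioc a b, gridNorm t N S (H' x) u :=
  le_trans (Finset.sum_le_sum fun _ _ => gridVar_sub_le_lintegral hab fun _ _ => h _)
    (sum_lintegral_le_lintegral_sum _ _ _)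

end Grid

/-! ### Composition with a smooth function -/

section Composition

variable {ι : Type*} [DecidableEq ι] [Fintype ι]

/-- Composition with a smooth function is bounded for the grid norms, uniformly in the grid. -/
theorem exists_gridNorm_comp_le {d : ℕ} (S : Finset ι) (f : EuclideanSpace ℝ (Fin d) → ℝ)
    (hf : ContDiff ℝ S.card f) (hc : HasCompactSupport f) (R : ℝ≥0∞) (hR : R ≠ ⊤) :
    ∃ C : ℝ≥0∞, C ≠ ⊤ ∧ ∀ (t : ι → ℕ → ℝ) (N : ι → ℕ) (u : ι → ℝ)
      (τ : (ι → ℝ) → EuclideanSpace ℝ (Fin d)), (∀ i ∈ S, t i (N i) = u i) →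
      (∀ j, gridNorm t N S (fun p => τ p j) u ≤ R) →
      gridNorm t N S (fun p => f (τ p)) u ≤ C := by
  induction S using Finset.induction_on generalizing f with
  | empty =>
    obtain ⟨C, hC⟩ := hc.exists_bound_of_continuous hf.continuous
    refine ⟨ENNReal.ofReal C, ENNReal.ofReal_ne_top, fun t N u τ _ _ => ?_⟩
    rw [gridNorm_empty, ← ofReal_norm]
    exact ENNReal.ofReal_le_ofReal (hC _)
  | insert i S hi ih =>
    rw [Finset.card_insert_of_notMem hi] at hf
    let f' : Fin d → EuclideanSpace ℝ (Fin d) → ℝ :=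
      fun j x => fderiv ℝ f x (EuclideanSpace.single j 1)
    have hf' : ∀ j, ContDiff ℝ S.card (f' j) := fun j =>
      (hf.fderiv_right (by push_cast; exact le_rfl)).clm_apply contDiff_const
    have hc' : ∀ j, HasCompactSupport (f' j) := fun j => hc.fderiv_apply ℝ _
    obtain ⟨C₀, hC₀, h₀⟩ := ih f (hf.of_le (by push_cast; exact le_self_add)) hc
    choose C hC h using fun j => ih (f' j) (hf' j) (hc' j)
    -- `C₀` bounds the undifferenced part; in the rest, `R` bounds the summed norms of `Δτⱼ`, `C j`
    -- the norm of `∂ⱼf ∘ σₓ`, and the power of 3 comes from the product rule. As `C j` is uniform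
    -- in the inner map, it serves for every `σₓ`.
    refine ⟨C₀ + ∑ j, 3 ^ S.card * (R * C j), ?_, fun t N u τ htu hτ => ?_⟩
    · refine ENNReal.add_ne_top.2 ⟨hC₀, ENNReal.sum_ne_top.2 fun j _ => ?_⟩
      exact ENNReal.mul_ne_top (by simp) (ENNReal.mul_ne_top hR (hC j))
    have htu' : ∀ j ∈ S, t j (N j) = u j := fun j hj => htu j (Finset.mem_insert_of_mem hj)
    have hui := htu i (Finset.mem_insert_self i S)
    have hle : ∀ F, gridNorm t N S F u ≤ gridNorm t N (insert i S) F u := fun F => by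
      rw [gridNorm_insert hi]; exact le_self_add
    have hle' : ∀ F, ∑ n ∈ Finset.range (N i), gridNorm t N S (axisDiff t i n F) u
        ≤ gridNorm t N (insert i S) F u := fun F => by
      rw [gridNorm_insert hi]; exact le_add_self
    rw [gridNorm_insert hi]
    refine add_le_add (h₀ t N u τ htu' fun j => (hle _).trans (hτ j)) ?_
    have key : ∀ n ∈ Finset.range (N i),
        gridNorm t N S (axisDiff t i n fun p => f (τ p)) u ≤ ∑ j, 3 ^ S.card *
          (gridNorm t N S (axisDiff t i n fun p => τ p j) u * C j) := by
      intro n hn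
      have hn' : n < N i := Finset.mem_range.1 hn
      let a : (ι → ℝ) → EuclideanSpace ℝ (Fin d) := fun p => τ (Function.update p i (t i n))
      let b : (ι → ℝ) → EuclideanSpace ℝ (Fin d) :=
        fun p => τ (Function.update p i (t i (n + 1)))
      let σ : ℝ → (ι → ℝ) → EuclideanSpace ℝ (Fin d) := fun x p => a p + x • (b p - a p)
      have hdecomp : (axisDiff t i n fun p => f (τ p))
          = fun p => f (σ 1 p) - f (σ 0 p) := by
        ext p; simp [axisDiff, σ, a, b]
      have hderiv : ∀ p, ∀ x ∈ Set.Icc (0 : ℝ) 1, HasDerivAt (fun y => f (σ y p))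
          (∑ j, axisDiff t i n (fun p => τ p j) p * f' j (σ x p)) x := by
        intro p x _
        have h1 : HasDerivAt (fun y => σ y p) (b p - a p) x := by
          simpa [σ] using ((hasDerivAt_id x).smul_const (b p - a p)).const_add (a p)
        have h2 : HasFDerivAt f (fderiv ℝ f (σ x p)) (σ x p) :=
          (hf.differentiable (by simp)).differentiableAt.hasFDerivAt
        have h3 := h2.comp_hasDerivAt x h1
        have h4 : b p - a p = ∑ j, (b p - a p) j • EuclideanSpace.single j (1 : ℝ) := by
          simpa using ((EuclideanSpace.basisFun (Fin d) ℝ).sum_repr (b p - a p)).symm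
        have h5 : fderiv ℝ f (σ x p) (b p - a p)
            = ∑ j, axisDiff t i n (fun p => τ p j) p * f' j (σ x p) := by
          conv_lhs => rw [h4, map_sum]
          simp [axisDiff, a, b, f']
        rw [h5] at h3
        exact h3
      rw [hdecomp]
      refine (gridNorm_sub_le_lintegral (H := fun x p => f (σ x p)) zero_le_one hderiv).trans ?_
      have hbound : ∀ x ∈ Set.Ioc (0 : ℝ) 1,
          gridNorm t N S (fun p => ∑ j, axisDiff t i n (fun p => τ p j) p * f' j (σ x p)) u
            ≤ ∑ j, 3 ^ S.card *
              (gridNorm t N S (axisDiff t i n fun p => τ p j) u * C j) := by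
        intro x hx
        -- A convex combination of two slices of `τ` keeps the bound `R`.
        have hσ : ∀ j, gridNorm t N S (fun p => σ x p j) u ≤ R := by
          intro j
          have h1 : (fun p => σ x p j) = fun p =>
              (1 - x) * τ (Function.update p i (t i n)) j
                + x * τ (Function.update p i (t i (n + 1))) j := by
            ext p; simp [σ, a, b]; ring
          rw [h1]
          refine (gridNorm_add_le _ _ _).trans ?_
          rw [gridNorm_const_mul, gridNorm_const_mul]
          calc _ ≤ ‖1 - x‖ₑ * R + ‖x‖ₑ * R := by
                gcongr
                · exact (gridNorm_slice_le (F := fun p => τ p j) hi hui hn'.le).trans (hτ j)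
                · exact (gridNorm_slice_le (F := fun p => τ p j) hi hui hn').trans (hτ j)
            _ = R := by
                rw [← add_mul, Real.enorm_of_nonneg (by linarith [hx.2]),
                  Real.enorm_of_nonneg hx.1.le,
                  ← ENNReal.ofReal_add (by linarith [hx.2]) hx.1.le]
                simp
        refine (gridNorm_sum_le _ _ _).trans (Finset.sum_le_sum fun j _ => ?_)
        refine (gridNorm_mul_le htu' _ _).trans ?_
        gcongr
        exact h j t N u (σ x) htu' hσ
      calc _ ≤ ∫⁻ _ in Set.Ioc (0 : ℝ) 1, ∑ j, 3 ^ S.card *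
              (gridNorm t N S (axisDiff t i n fun p => τ p j) u * C j) :=
            setLIntegral_mono' measurableSet_Ioc hbound
        _ = _ := by simp
    calc _ ≤ _ := Finset.sum_le_sum key
      _ = ∑ j, 3 ^ S.card * ((∑ n ∈ Finset.range (N i),
            gridNorm t N S (axisDiff t i n fun p => τ p j) u) * C j) := by
          rw [Finset.sum_comm]
          simp only [Finset.mul_sum, Finset.sum_mul]
      _ ≤ _ := by
          gcongr with j
          exact (hle' _).trans (hτ j)

end Composition

/-! ### Grid variation bounded by the mixed derivative -/

section Derivatives

variable {ι : Type*} [DecidableEq ι] [Fintype ι]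

/-- Over a grid in the open cube, the grid variation of an iterated derivative is bounded by the
iterated integral of a measurable majorant of the top mixed derivative. -/
theorem gridVar_le_lmarginal {D : Finset ι → (ι → ℝ) → ℝ}
    (hD : ∀ (v : Finset ι) (i : ι), i ∉ v →
      ∀ u : ι → ℝ, (∀ k, u k ∈ Set.Ioc (0 : ℝ) 1) → (∀ k ∈ insert i v, u k < 1) →
        HasDerivAt (fun x : ℝ => D v (Function.update u i x)) (D (insert i v) u) (u i))
    {v : Finset ι} {H : (ι → ℝ) → ℝ≥0∞} (hH : Measurable H)
    (hDH : ∀ u : ι → ℝ, (∀ i ∈ v, u i ∈ Set.Ioo (0 : ℝ) 1) → (∀ i ∉ v, u i = 1) →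
      ‖D v u‖ₑ ≤ H u)
    {t : ι → ℕ → ℝ} (ht : ∀ i, Monotone (t i)) (ht' : ∀ i k, t i k ∈ Set.Ioo (0 : ℝ) 1)
    (N : ι → ℕ) {s : Finset ι} (hs : s ⊆ v) {u : ι → ℝ}
    (hu : ∀ i ∈ v, u i ∈ Set.Ioo (0 : ℝ) 1) (hu' : ∀ i ∉ v, u i = 1) :
    gridVar t N s (D (v \ s)) u
      ≤ lmarginal (fun _ => volume.restrict (Set.Icc (0 : ℝ) 1)) s H u := by
  -- The directions in `s` are differenced, those in `v \ s` already differentiated. Each step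
  -- trades a difference for a derivative under an integral.
  induction s using Finset.induction_on generalizing u with
  | empty => simpa [gridVar_empty] using hDH u hu hu'
  | insert i s hi ih =>
    have hiv : i ∈ v := hs (Finset.mem_insert_self i s)
    have hsv : s ⊆ v := (Finset.subset_insert i s).trans hs
    have hins : insert i (v \ insert i s) = v \ s := by
      ext j
      by_cases hj : j = i
      · subst hj; simp [hi, hiv]
      · simp [hj]
    rw [gridVar_insert hi, lmarginal_insert _ hH hi]
    have hcell : ∀ n ∈ Finset.range (N i),
        gridVar t N s (axisDiff t i n (D (v \ insert i s))) u
          ≤ ∫⁻ x in Set.Ioc (t i n) (t i (n + 1)),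
            lmarginal (fun _ => volume.restrict (Set.Icc (0 : ℝ) 1)) s H
              (Function.update u i x) := by
      intro n _
      have hIoo : ∀ x ∈ Set.Icc (t i n) (t i (n + 1)), x ∈ Set.Ioo (0 : ℝ) 1 := fun x hx =>
        ⟨(ht' i n).1.trans_le hx.1, hx.2.trans_lt (ht' i (n + 1)).2⟩
      refine (gridVar_sub_le_lintegral
        (H := fun x p => D (v \ insert i s) (Function.update p i x))
        (H' := fun x p => D (v \ s) (Function.update p i x)) (ht i (Nat.le_succ n))
        ?_).trans (setLIntegral_mono' measurableSet_Ioc fun x hx => ?_)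
      · intro w k x hx
        have hv : ∀ j ∈ v, Function.update (gridVertex t s w k u) i x j ∈ Set.Ioo (0 : ℝ) 1 := by
          intro j hj
          by_cases hji : j = i
          · subst hji; simpa using hIoo x hx
          · simp only [Function.update_of_ne hji, gridVertex]
            split_ifs
            · exact ht' _ _
            · exact ht' _ _
            · exact hu j hj
        have hnv : ∀ j ∉ v, Function.update (gridVertex t s w k u) i x j = 1 := by
          intro j hj
          have hji : j ≠ i := fun h => hj (h ▸ hiv)
          have hjs : j ∉ s := fun h => hj (hsv h)
          simp [Function.update_of_ne hji, gridVertex, hjs, hu' j hj]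
        have := hD (v \ insert i s) i (by simp)
          (Function.update (gridVertex t s w k u) i x) (fun j => ?_) (fun j hj => ?_)
        · simpa [hins] using this
        · by_cases hj : j ∈ v
          · exact Set.Ioo_subset_Ioc_self (hv j hj)
          · rw [hnv j hj]; simp
        · rw [hins] at hj
          exact (hv j (Finset.mem_sdiff.1 hj).1).2
      · rw [gridVar_update_base hi]
        refine ih hsv (fun j hj => ?_) (fun j hj => ?_)
        · by_cases hji : j = i
          · subst hji; simpa using hIoo x (Set.Ioc_subset_Icc_self hx)
          · simpa [hji] using hu j hj
        · have hji : j ≠ i := fun h => hj (h ▸ hiv)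
          simpa [hji] using hu' j hj
    refine (Finset.sum_le_sum hcell).trans ?_
    -- The cells of one axis are disjoint and lie in `[0,1]`.
    rw [← lintegral_biUnion_finset (t := fun n => Set.Ioc (t i n) (t i (n + 1)))
      (fun a _ b _ hab => (ht i).pairwise_disjoint_on_Ioc_succ hab)
      (fun _ _ => measurableSet_Ioc)]
    refine lintegral_mono_set (Set.iUnion₂_subset fun n _ x hx => ?_)
    exact ⟨((ht' i n).1.trans hx.1).le, hx.2.trans (ht' i (n + 1)).2.le⟩

/-- A bound for the grid variation on all grids in the open cube extends to the grids in the closed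
cube, for functions that are continuous in each variable. -/
theorem gridVar_le_of_forall_interior {g : (ι → ℝ) → ℝ}
    (hg : ∀ u ∈ Set.Icc (0 : ι → ℝ) 1, ∀ i,
      ContinuousOn (fun x : ℝ => g (Function.update u i x)) (Set.Icc 0 1))
    {N : ι → ℕ} {v : Finset ι} {C : ℝ≥0∞}
    (hC : ∀ t : ι → ℕ → ℝ, (∀ i, Monotone (t i)) → (∀ i k, t i k ∈ Set.Ioo (0 : ℝ) 1) →
      gridVar t N v g 1 ≤ C)
    {t : ι → ℕ → ℝ} (ht : ∀ i, Monotone (t i)) (ht' : ∀ i k, t i k ∈ Set.Icc (0 : ℝ) 1) :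
    gridVar t N v g 1 ≤ C := by
  suffices h : ∀ (S : Finset ι) (t : ι → ℕ → ℝ), (∀ i, Monotone (t i)) →
      (∀ i k, t i k ∈ Set.Icc (0 : ℝ) 1) → (∀ i ∉ S, ∀ k, t i k ∈ Set.Ioo (0 : ℝ) 1) →
      gridVar t N v g 1 ≤ C from h Finset.univ t ht ht' (by simp)
  intro S
  induction S using Finset.induction_on with
  | empty => exact fun t h1 _ h3 => hC t h1 fun i => h3 i (by simp)
  | insert i S hi ih =>
    intro t ht hIcc hIoo
    -- Contracting axis `i` towards 1/2 puts its nodes in the open interval and keeps their order.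
    -- Only coordinate `i` of a vertex moves, so separate continuity suffices as `ε → 0`.
    let r : ℝ → ι → ℕ → ℝ := fun ε => Function.update t i fun k => (1 - ε) * t i k + ε / 2
    have hlim : Filter.Tendsto (fun ε => gridVar (r ε) N v g 1) (nhdsWithin 0 (Set.Ioo 0 1))
        (nhds (gridVar t N v g 1)) := by
      refine tendsto_finsetSum _ fun k _ => Filter.Tendsto.enorm ?_
      refine tendsto_finsetSum _ fun w _ => Filter.Tendsto.const_mul _ ?_
      have hmem : gridVertex t v w k 1 ∈ Set.Icc (0 : ι → ℝ) 1 := by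
        rw [← Set.pi_univ_Icc]
        intro j _
        simp only [gridVertex]
        split_ifs
        · exact hIcc _ _
        · exact hIcc _ _
        · simp
      by_cases hiv : i ∈ v
      · set y := gridVertex t v w k 1 i with hy
        have hyI : y ∈ Set.Icc (0 : ℝ) 1 := ⟨hmem.1 i, hmem.2 i⟩
        have heq : ∀ ε, gridVertex (r ε) v w k 1
            = Function.update (gridVertex t v w k 1) i ((1 - ε) * y + ε / 2) := by
          intro ε
          ext j
          by_cases hj : j = i
          · subst hj
            by_cases hjw : j ∈ w <;> simp [gridVertex, r, hy, hiv, hjw]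
          · simp [gridVertex, r, hj]
        simp only [heq]
        have hcont := hg _ hmem i y hyI
        rw [ContinuousWithinAt, hy, Function.update_eq_self, ← hy] at hcont
        refine hcont.comp (tendsto_nhdsWithin_iff.2 ⟨?_, ?_⟩)
        · have : Continuous fun ε : ℝ => (1 - ε) * y + ε / 2 := by fun_prop
          simpa using (this.tendsto 0).mono_left nhdsWithin_le_nhds
        · filter_upwards [self_mem_nhdsWithin] with ε hε
          constructor <;> nlinarith [hε.1, hε.2, hyI.1, hyI.2]
      · have heq : ∀ ε, gridVertex (r ε) v w k 1 = gridVertex t v w k 1 := by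
          intro ε
          ext j
          by_cases hj : j = i
          · subst hj; simp [gridVertex, hiv]
          · simp [gridVertex, r, hj]
        simp only [heq]
        exact tendsto_const_nhds
    have : (nhdsWithin (0 : ℝ) (Set.Ioo 0 1)).NeBot := by
      rw [nhdsWithin_Ioo_eq_nhdsGT zero_lt_one]; infer_instance
    refine le_of_tendsto hlim ?_
    filter_upwards [self_mem_nhdsWithin] with ε hε
    have hri : ∀ k, r ε i k ∈ Set.Ioo (0 : ℝ) 1 := by
      intro k
      have := hIcc i k
      simp only [r, Function.update_self]
      constructor <;> nlinarith [hε.1, hε.2, this.1, this.2]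
    refine ih (r ε) (fun j => ?_) (fun j k => ?_) (fun j hj k => ?_)
    · by_cases hji : j = i
      · subst hji
        simp only [r, Function.update_self]
        intro a b hab
        have := ht j hab
        have h1 : 0 ≤ 1 - ε := by linarith [hε.2]
        dsimp only
        gcongr
      · simpa [r, hji] using ht j
    · by_cases hji : j = i
      · subst hji; exact Set.Ioo_subset_Icc_self (hri k)
      · simpa [r, hji] using hIcc j k
    · by_cases hji : j = i
      · subst hji; exact hri k
      · simpa [r, hji] using hIoo j (by simp [hji, hj]) k

/-- Take a measurable representative and add `∞` on a measurable null set containing the points of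
disagreement. Iterated integrals need a measurable integrand that dominates everywhere, not just
almost everywhere. -/
theorem exists_measurable_ge_lintegral_eq {α : Type*} [MeasurableSpace α] {μ : Measure α}
    {f : α → ℝ≥0∞} (hf : AEMeasurable f μ) :
    ∃ H : α → ℝ≥0∞, Measurable H ∧ f ≤ H ∧ ∫⁻ x, H x ∂μ = ∫⁻ x, f x ∂μ := by
  have hnull : μ (toMeasurable μ {x | f x ≠ hf.mk f x}) = 0 := by
    rw [measure_toMeasurable]; exact hf.ae_eq_mk
  set Z := toMeasurable μ {x | f x ≠ hf.mk f x}
  refine ⟨fun x => hf.mk f x + Z.indicator (fun _ => ⊤) x,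
    hf.measurable_mk.add (measurable_const.indicator (measurableSet_toMeasurable _ _)),
    fun x => ?_, ?_⟩
  · by_cases hx : x ∈ Z
    · simp [hx]
    · have : f x = hf.mk f x := by
        by_contra h
        exact hx (subset_toMeasurable _ _ h)
      simp [hx, ← this]
  · refine lintegral_congr_ae ?_
    filter_upwards [hf.ae_eq_mk, measure_eq_zero_iff_ae_notMem.1 hnull] with x h1 h2
    simp [h2, ← h1]

end Derivatives

/-! ### Faces of the cube and Vitali variation -/

section Face

variable {m : ℕ}

theorem boxDiff_faceRestrict (v : Finset (Fin m)) (g : (Fin m → ℝ) → ℝ) (t : Fin m → ℕ → ℝ)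
    (k : Fin m → ℕ) :
    boxDiff (faceRestrict v g) (fun i : v => t i (k i)) (fun i : v => t i (k i + 1))
      = gridDiff t v k g 1 := by
  unfold boxDiff gridDiff
  refine Finset.sum_nbij' (fun w => w.map (Function.Embedding.subtype _))
    (fun w => w.subtype (· ∈ v)) ?_ ?_ ?_ ?_ ?_
  · intro w _
    rw [Finset.mem_powerset]
    intro i hi
    obtain ⟨j, _, rfl⟩ := Finset.mem_map.1 hi
    exact j.2
  · intro w _; simp
  · intro w _; ext j; simp
  · intro w hw
    exact Finset.subtype_map_of_mem fun i hi => Finset.mem_powerset.1 hw hi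
  · intro w _
    rw [Finset.card_map, faceRestrict]
    congr 2
    ext i
    by_cases hi : i ∈ v
    · simp [gridVertex, hi]
    · simp [gridVertex, hi]

theorem sum_boxDiff_faceRestrict (v : Finset (Fin m)) (g : (Fin m → ℝ) → ℝ)
    (t : Fin m → ℕ → ℝ) (N : Fin m → ℕ) :
    ∑ k ∈ Fintype.piFinset (fun i : v => Finset.range (N i)),
      ENNReal.ofReal |boxDiff (faceRestrict v g) (fun i => t i (k i)) (fun i => t i (k i + 1))|
      = gridVar t N v g 1 := by
  unfold gridVar
  refine Finset.sum_nbij' (fun k i => if h : i ∈ v then k ⟨i, h⟩ else 0) (fun k i => k i)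
    ?_ ?_ ?_ ?_ ?_
  · intro k hk
    rw [Fintype.mem_piFinset] at hk ⊢
    intro i
    by_cases hi : i ∈ v
    · simpa [hi] using hk ⟨i, hi⟩
    · simp [hi]
  · intro k hk
    rw [Fintype.mem_piFinset] at hk ⊢
    intro i
    simpa using hk i
  · intro k _; ext i; simp
  · intro k hk
    rw [Fintype.mem_piFinset] at hk
    ext i
    by_cases hi : i ∈ v
    · simp [hi]
    · simpa [hi, eq_comm] using hk i
  · intro k _
    rw [← boxDiff_faceRestrict, ← Real.enorm_eq_ofReal_abs]
    simp

/-- The Vitali variation on a face is bounded by any bound for the grid variations over the grids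
on the whole cube. -/
theorem vitaliVariation_faceRestrict_le (v : Finset (Fin m)) (g : (Fin m → ℝ) → ℝ) (C : ℝ≥0∞)
    (hC : ∀ (t : Fin m → ℕ → ℝ) (N : Fin m → ℕ), (∀ i, Monotone (t i)) →
      (∀ i k, t i k ∈ Set.Icc (0 : ℝ) 1) → (∀ i, t i (N i) = 1) → gridVar t N v g 1 ≤ C) :
    vitaliVariation (faceRestrict v g) ≤ C := by
  unfold vitaliVariation
  refine iSup_le fun N => iSup_le fun t => iSup_le fun ht => ?_
  -- Nodes beyond index `N i` may exceed 1, hence the truncation; the axes outside `v` get the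
  -- trivial partition 0, 1.
  let t' : Fin m → ℕ → ℝ := fun i k => if h : i ∈ v then min (t ⟨i, h⟩ k) 1 else min (k : ℝ) 1
  let N' : Fin m → ℕ := fun i => if h : i ∈ v then N ⟨i, h⟩ else 1
  have hN' : ∀ i : v, N' i = N i := fun i => by simp [N']
  have ht' : ∀ (i : v) k, k ≤ N i → t' i k = t i k := by
    intro i k hk
    have := (ht i).1 hk
    rw [(ht i).2.2] at this
    simp [t', this]
  refine le_trans (le_of_eq ?_) (hC t' N' ?_ ?_ ?_)
  · rw [← sum_boxDiff_faceRestrict]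
    simp only [hN']
    refine Finset.sum_congr rfl fun k hk => ?_
    have hk' : ∀ i, k i < N i := fun i => by
      simpa using Fintype.mem_piFinset.1 hk i
    have h1 : (fun i : v => t' i (k i)) = fun i => t i (k i) :=
      funext fun i => ht' i _ (hk' i).le
    have h2 : (fun i : v => t' i (k i + 1)) = fun i => t i (k i + 1) :=
      funext fun i => ht' i _ (hk' i)
    rw [h1, h2]
  · intro i a b hab
    by_cases hi : i ∈ v
    · simpa only [t', hi, dif_pos] using min_le_min_right 1 ((ht ⟨i, hi⟩).1 hab)
    · simpa only [t', hi, dif_neg, not_false_eq_true] using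
        min_le_min_right 1 (Nat.cast_le.2 hab : (a : ℝ) ≤ b)
  · intro i k
    by_cases hi : i ∈ v
    · have := (ht ⟨i, hi⟩).1 (Nat.zero_le k)
      rw [(ht ⟨i, hi⟩).2.1] at this
      simp [t', hi, this]
    · simp [t', hi]
  · intro i
    by_cases hi : i ∈ v
    · simp [t', N', hi, (ht ⟨i, hi⟩).2.2]
    · simp [t', N', hi]

/-- The grid variations of a function on a face are bounded, uniformly in the grid, if the mixed
derivative on that face is integrable. -/
theorem IsMixedPartials.exists_gridVar_le {g : (Fin m → ℝ) → ℝ}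
    {D : Finset (Fin m) → (Fin m → ℝ) → ℝ} (hD : IsMixedPartials g D) {v : Finset (Fin m)}
    (hint : Integrable (faceRestrict v (D v)) (volume.restrict (Set.Icc (0 : v → ℝ) 1))) :
    ∃ C : ℝ≥0∞, C ≠ ⊤ ∧ ∀ (t : Fin m → ℕ → ℝ) (N : Fin m → ℕ), (∀ i, Monotone (t i)) →
      (∀ i k, t i k ∈ Set.Icc (0 : ℝ) 1) → gridVar t N v g 1 ≤ C := by
  obtain ⟨H, hH, hle, hlint⟩ := exists_measurable_ge_lintegral_eq hint.1.enorm
  refine ⟨∫⁻ x in Set.Icc (0 : v → ℝ) 1, H x, ?_, fun t N ht ht' => ?_⟩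
  · rw [hlint]; exact hint.2.ne
  refine gridVar_le_of_forall_interior hD.continuousOn (fun t ht ht' => ?_) ht ht'
  -- The coordinates in `v` are overwritten by grid nodes; 1/2 only keeps the base point inside the
  -- open face.
  let u : Fin m → ℝ := fun i => if i ∈ v then 1 / 2 else 1
  have hgD : gridVar t N v g 1 = gridVar t N v (D (v \ v)) u := by
    have h1 : ∀ w k, gridVertex t v w k 1 = gridVertex t v w k u := by
      intro w k
      ext i
      by_cases hi : i ∈ v <;> simp [gridVertex, hi, u]
    have h2 : gridVar t N v g 1 = gridVar t N v g u := by
      simp only [gridVar, gridDiff, h1]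
    rw [h2, Finset.sdiff_self]
    refine gridVar_congr (A := Set.Icc 0 1) (fun w k => ?_) fun p hp => (hD.empty p hp).symm
    rw [← Set.pi_univ_Icc]
    intro i _
    simp only [gridVertex, u]
    split_ifs
    · exact Set.Ioo_subset_Icc_self (ht' _ _)
    · exact Set.Ioo_subset_Icc_self (ht' _ _)
    · simp
  rw [hgD]
  refine (gridVar_le_lmarginal (H := fun u => H fun i : v => u i) hD.hasDerivAt
    (hH.comp (by fun_prop)) (fun p _ hp' => ?_) ht ht' N subset_rfl ?_ ?_).trans (le_of_eq ?_)
  · refine le_trans (le_of_eq ?_) (hle fun i : v => p i)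
    simp only [faceRestrict]
    congr 2
    ext i
    by_cases hi : i ∈ v
    · simp [hi]
    · simp [hi, hp' i hi]
  · intro i hi
    simp only [u, hi, if_true]
    norm_num
  · intro i hi; simp [u, hi]
  · have h1 : (volume.restrict (Set.Icc (0 : v → ℝ) 1))
        = Measure.pi fun _ => volume.restrict (Set.Icc (0 : ℝ) 1) := by
      rw [← Set.pi_univ_Icc, volume_pi, Measure.restrict_pi_pi]
      rfl
    rw [h1, lmarginal]
    simp [Function.updateFinset]

end Face

/-! ### Cut-off and conclusion -/

/-- Multiply by a smooth cut-off equal to 1 near `X` and vanishing near the complement of a bounded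
neighbourhood. A global function is needed because the segments between values of `τ` may leave `X`,
and even `U`. -/
theorem exists_contDiff_hasCompactSupport_eqOn {E : Type*} [NormedAddCommGroup E]
    [NormedSpace ℝ E] [FiniteDimensional ℝ E] {n : ℕ} {X U : Set E} (hX : IsCompact X)
    (hU : IsOpen U) (hXU : X ⊆ U) {f : E → ℝ} (hf : ContDiffOn ℝ n f U) :
    ∃ g : E → ℝ, ContDiff ℝ n g ∧ HasCompactSupport g ∧ Set.EqOn g f X := by
  obtain ⟨r, hr⟩ := hX.isBounded.subset_ball (0 : E)
  have hV : IsOpen (U ∩ Metric.ball 0 r) := hU.inter Metric.isOpen_ball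
  obtain ⟨χ, h0, h1, -⟩ := exists_contMDiffMap_zero_one_nhds_of_isClosed
    (modelWithCornersSelf ℝ E) (n := (n : ℕ∞)) hV.isClosed_compl hX.isClosed
    (Set.disjoint_left.2 fun x hx hxX => hx ⟨hXU hxX, hr hxX⟩)
  have hχ : ContDiff ℝ n χ := χ.contMDiff.contDiff
  rw [eventually_nhdsSet_iff_forall] at h0
  refine ⟨fun x => χ x * f x, contDiff_iff_contDiffAt.2 fun x => ?_, ?_, fun x hx => ?_⟩
  · by_cases hx : x ∈ U ∩ Metric.ball 0 r
    · exact hχ.contDiffAt.mul (hf.contDiffAt (hU.mem_nhds hx.1))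
    · refine (contDiffAt_const (c := (0 : ℝ))).congr_of_eventuallyEq ?_
      filter_upwards [h0 x hx] with y hy
      simp [hy]
  · refine HasCompactSupport.intro (isCompact_closedBall (0 : E) r) fun x hx => ?_
    have : χ x = 0 := (h0 x fun h => hx (Metric.ball_subset_closedBall h.2)).self_of_nhds
    simp [this]
  · have : χ x = 1 := h1.self_of_nhdsSet x hx
    simp [this]

theorem theorem2 {m d : ℕ} (X : Set (EuclideanSpace ℝ (Fin d)))
    (hXc : IsClosed X) (hXb : Bornology.IsBounded X)
    (τ : (Fin m → ℝ) → EuclideanSpace ℝ (Fin d))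
    (hτ : Set.MapsTo τ (Set.Icc 0 1) X)
    (D : Fin d → Finset (Fin m) → (Fin m → ℝ) → ℝ)
    (hD : ∀ j, IsMixedPartials (fun u => τ u j) (D j))
    (p : Fin d → ℝ≥0∞) (hp : ∀ j, 1 ≤ p j) (hpsum : ∑ j, (p j)⁻¹ ≤ 1)
    (hLp : ∀ j, ∀ v : Finset (Fin m), v.Nonempty →
      MemLp (faceRestrict v (D j v)) (p j) (volume.restrict (Set.Icc (0 : v → ℝ) 1))) :
    ∀ f : EuclideanSpace ℝ (Fin d) → ℝ, IsCnOn m X f → IsBVHK (f ∘ τ) := by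
  rintro f ⟨U, hU, hXU, hf⟩
  obtain ⟨g, hg, hgc, hgf⟩ := exists_contDiff_hasCompactSupport_eqOn
    (Metric.isCompact_of_isClosed_isBounded hXc hXb) hU hXU hf
  have hτvar : ∀ j, ∀ v : Finset (Fin m), ∃ C : ℝ≥0∞, C ≠ ⊤ ∧
      ∀ (t : Fin m → ℕ → ℝ) (N : Fin m → ℕ), (∀ i, Monotone (t i)) →
        (∀ i k, t i k ∈ Set.Icc (0 : ℝ) 1) → gridVar t N v (fun u => τ u j) 1 ≤ C := by
    intro j v
    rcases v.eq_empty_or_nonempty with rfl | hv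
    -- The empty set of directions belongs to the norm too: it contributes the value at the anchor
    -- 1.
    · exact ⟨‖τ 1 j‖ₑ, enorm_ne_top, fun t N _ _ => (gridVar_empty _ _).le⟩
    · have : IsFiniteMeasure (volume.restrict (Set.Icc (0 : v → ℝ) 1)) :=
        ⟨by simpa using isCompact_Icc.measure_lt_top⟩
      exact (hD j).exists_gridVar_le ((hLp j v hv).integrable (hp j))
  choose C hC hCle using hτvar
  obtain ⟨B, hB, hBle⟩ := exists_gridNorm_comp_le (Finset.univ : Finset (Fin m)) g
    (by simpa using hg) hgc (∑ j, ∑ v, C j v)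
    (ENNReal.sum_ne_top.2 fun j _ => ENNReal.sum_ne_top.2 fun v _ => hC j v)
  refine lt_of_le_of_lt (Finset.sum_le_sum fun v _ =>
    vitaliVariation_faceRestrict_le v (f ∘ τ) B fun t N ht ht' htN => ?_)
    (ENNReal.sum_lt_top.2 fun v _ => hB.lt_top)
  have hfg : gridVar t N v (f ∘ τ) 1 = gridVar t N v (fun u => g (τ u)) 1 := by
    refine gridVar_congr (A := Set.Icc 0 1) (fun w k => ?_) fun q hq => (hgf (hτ hq)).symm
    rw [← Set.pi_univ_Icc]
    intro i _
    simp only [gridVertex]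
    split_ifs
    · exact ht' _ _
    · exact ht' _ _
    · simp
  rw [hfg]
  refine le_trans ?_ (hBle t N 1 τ (fun i _ => htN i) fun j => ?_)
  · exact Finset.single_le_sum (f := fun v => gridVar t N v (fun u => g (τ u)) 1)
      (fun _ _ => zero_le) (Finset.mem_powerset.2 (Finset.subset_univ v))
  · rw [gridNorm, Finset.powerset_univ]
    refine (Finset.sum_le_sum fun v _ => hCle j v t N ht ht').trans ?_
    exact Finset.single_le_sum (f := fun j => ∑ v, C j v) (fun _ _ => zero_le)
      (Finset.mem_univ j)
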